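/- Let $n\ge 1$, let $\mathbb{B}^n$ be the open unit ball of $\mathbb{C}^n$ with boundary $\mathbb{S}^{2n-1}$, let $\sigma$ be the surface measure on $\mathbb{S}^{2n-1}$, and let $G$ be a finite subgroup of the unitary group $U(n)$. Call a function $f$ on $\mathbb{B}^n$ or on $\mathbb{S}^{2n-1}$ $G$-invariant if $f(\tau z)=f(z)$ for all $\tau\in G$ and all $z$. Let $w:\mathbb{S}^{2n-1}\to\mathbb{R}$ be a continuous, $G$-invariant function that is positive $\sigma$-almost everywhere and satisfies $\log w\in L^1(\mathbb{S}^{2n-1},\sigma)$. Then $w$ is admissible, that is, there exists a nowhere vanishing $G$-invariant holomorphic function $g$ on $\mathbb{B}^n$ such that for $\sigma$-almost every $\zeta\in\mathbb{S}^{2n-1}$ the non-tangential limit $g^*(\zeta)$ exists and $|g^*(\zeta)|^2=w(\zeta)$. Here $g^*(\zeta)$ is the non-tangential limit of $g$ at $\zeta$ if for every $\alpha>1$, $g(z)\to g^*(\zeta)$ as $z\to\zeta$ within $\{z\in\mathbb{B}^n:\ |z-\zeta|<\alpha(1-|z|)\}$. -/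

import Mathlib

open Set Filter Topology MeasureTheory

noncomputable section

namespace BallAdmissible

/-- The surface (induced Lebesgue) measure `σ` on the unit sphere `𝕊^{2n-1}` of `ℂⁿ`. -/
def sphereMeasure (n : ℕ) :
    Measure (Metric.sphere (0 : EuclideanSpace ℂ (Fin n)) 1) :=
  (volume : Measure (EuclideanSpace ℂ (Fin n))).toSphere

/-- A function is `G`-invariant on the set `S` if `f (τ z) = f z` for all `τ ∈ G`, `z ∈ S`;
here `τ ∈ U(n)` acts on `ℂⁿ` by matrix-vector multiplication. -/
def IsInvariantOn {n : ℕ} {Y : Type*} (G : Subgroup (Matrix.unitaryGroup (Fin n) ℂ))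
    (f : EuclideanSpace ℂ (Fin n) → Y) (S : Set (EuclideanSpace ℂ (Fin n))) : Prop :=
  ∀ τ ∈ G, ∀ z ∈ S, f (Matrix.toEuclideanLin (τ : Matrix (Fin n) (Fin n) ℂ) z) = f z

/-- The non-tangential approach region of aperture `α` at a boundary point `ζ` of the unit ball
`𝔹ⁿ`. -/
def approachRegion {n : ℕ} (α : ℝ) (ζ : EuclideanSpace ℂ (Fin n)) :
    Set (EuclideanSpace ℂ (Fin n)) :=
  {z | ‖z‖ < 1 ∧ ‖z - ζ‖ < α * (1 - ‖z‖)}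

/-- `f` has the non-tangential limit `L` at the boundary point `ζ` of the unit ball: `f z → L` as
`z → ζ` inside each approach region. For `α > 1` and `‖ζ‖ = 1` the region contains the radius
`{r • ζ : 0 ≤ r < 1}`, so `L` is then also the radial limit of `f` at `ζ`. -/
def HasNontangentialLimit {n : ℕ} (f : EuclideanSpace ℂ (Fin n) → ℂ)
    (ζ : EuclideanSpace ℂ (Fin n)) (L : ℂ) : Prop :=
  ∀ α : ℝ, 1 < α → Tendsto f (𝓝[approachRegion α ζ] ζ) (𝓝 L)

/-- A function `w` on the unit sphere of `ℂⁿ` is admissible (for `G`) if there is a nowhere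
vanishing `G`-invariant holomorphic function `g` on the unit ball whose non-tangential limit `g*`
exists and satisfies `|g*|² = w` almost everywhere on the sphere. -/
def IsAdmissible {n : ℕ} (G : Subgroup (Matrix.unitaryGroup (Fin n) ℂ))
    (w : EuclideanSpace ℂ (Fin n) → ℝ) : Prop :=
  ∃ g : EuclideanSpace ℂ (Fin n) → ℂ,
    DifferentiableOn ℂ g (Metric.ball 0 1) ∧
    (∀ z ∈ Metric.ball (0 : EuclideanSpace ℂ (Fin n)) 1, g z ≠ 0) ∧
    IsInvariantOn G g (Metric.ball 0 1) ∧
    ∀ᵐ ζ : Metric.sphere (0 : EuclideanSpace ℂ (Fin n)) 1 ∂(sphereMeasure n),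
      ∃ L : ℂ, HasNontangentialLimit g ζ L ∧ ‖L‖ ^ 2 = w ζ

end BallAdmissible

end

/-! It suffices to find `F` holomorphic on the ball whose nontangential limits satisfy `Re F* = M -
(1/2) log w` almost everywhere. As `w` is invariant, averaging `F` over `G` keeps this boundary
identity, and `g = exp (M - average)` is the required function.

`F` is a series of entire functions `q k`. Continuous truncations `v k` increase to `M - (1/2) log
w`, and the residual `V k = v k - Re ∑_{j<k} q j` is kept positive. The integral of `V` over `σ`
cannot measure progress, since the mean of `Re q` is `Re q(0)`, which is forced to be small. The
concave functional `∫ √V` can: to second order a perturbation lowers it by a multiple of `∫ (Re q)²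
/ V^(3/2)`. In `exists_improving_function`, `q` is a combination of Gaussian peaks centred on a
`1/√N`-net, with coefficients of modulus proportional to `V`. `exists_gaussian_sum_le` bounds `q` by
`V`, and `exists_phases` makes the first-order and cross terms harmless. This gains a factor `1 - c`
with `c` independent of `V`.

Hence `∫ √(V k)` is summable (`exists_entire_sequence`), so `∑ V k` converges almost everywhere.
Since `q k` is dominated by `V k + 2^(-k)` on ever wider approach regions, the limit may be taken
term by term. -/

/-! ### Gaussian sums and separated nets -/

lemma exp_neg_sq_le_one_add_rpow (d : ℕ) {t : ℝ} (ht : 0 ≤ t) :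
    Real.exp (-(t ^ 2 / 8)) ≤ (d.factorial * Real.exp 3) * (1 + t) ^ (-(d : ℝ)) := by
  have h1 : (1 + t) ^ d / d.factorial ≤ Real.exp (1 + t) :=
    Real.pow_div_factorial_le_exp _ (by positivity) d
  -- The maximum of `1 + t - t² / 8` is `3`, attained at `t = 4`.
  have h2 : Real.exp (-(t ^ 2 / 8)) * Real.exp (1 + t) ≤ Real.exp 3 := by
    rw [← Real.exp_add]
    exact Real.exp_le_exp.2 (by nlinarith [sq_nonneg (t - 4)])
  rw [Real.rpow_neg (by positivity), Real.rpow_natCast, ← div_eq_mul_inv,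
    le_div_iff₀ (by positivity)]
  rw [div_le_iff₀ (by positivity)] at h1
  calc Real.exp (-(t ^ 2 / 8)) * (1 + t) ^ d
      ≤ Real.exp (-(t ^ 2 / 8)) * (Real.exp (1 + t) * d.factorial) := by gcongr
    _ = (Real.exp (-(t ^ 2 / 8)) * Real.exp (1 + t)) * d.factorial := by ring
    _ ≤ Real.exp 3 * d.factorial := by gcongr
    _ = _ := by ring

lemma integrable_exp_neg_norm_sq (E : Type*) [NormedAddCommGroup E] [NormedSpace ℝ E]
    [FiniteDimensional ℝ E] [MeasurableSpace E] [BorelSpace E] (μ : Measure E)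
    [μ.IsAddHaarMeasure] : Integrable (fun x : E => Real.exp (-(‖x‖ ^ 2 / 8))) μ := by
  have h := (integrable_one_add_norm (μ := μ) (E := E)
    (r := ((Module.finrank ℝ E + 1 : ℕ) : ℝ)) (by push_cast; linarith)).const_mul
    (((Module.finrank ℝ E + 1).factorial : ℝ) * Real.exp 3)
  refine h.mono' (by fun_prop) (Eventually.of_forall fun x => ?_)
  rw [Real.norm_of_nonneg (Real.exp_nonneg _)]
  exact exp_neg_sq_le_one_add_rpow _ (norm_nonneg x)

/-- Gaussian sums over `1`-separated families are bounded uniformly. -/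
theorem exists_gaussian_sum_le (E : Type*) [NormedAddCommGroup E] [NormedSpace ℝ E]
    [FiniteDimensional ℝ E] [MeasurableSpace E] [BorelSpace E] (μ : Measure E)
    [μ.IsAddHaarMeasure] :
    ∃ C : ℝ, 1 ≤ C ∧ ∀ {ι : Type} (A : Finset ι) (f : ι → E),
      (∀ a ∈ A, ∀ b ∈ A, a ≠ b → 1 ≤ ‖f a - f b‖) →
      ∀ y : E, ∑ a ∈ A, Real.exp (-(‖y - f a‖ ^ 2 / 4)) ≤ C := by
  set m : ℝ := μ.real (Metric.ball (0 : E) (1 / 2)) with hm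
  have hm0 : 0 < m := by
    rw [hm, measureReal_def]
    exact ENNReal.toReal_pos (Metric.measure_ball_pos μ _ (by norm_num)).ne'
      measure_ball_lt_top.ne
  set I : ℝ := ∫ x : E, Real.exp (-(‖x‖ ^ 2 / 8)) ∂μ with hI
  refine ⟨max 1 (Real.exp 1 * I / m), le_max_left _ _, fun {ι} A f hf y => le_max_of_le_right ?_⟩
  rw [le_div_iff₀ hm0]
  have hint : Integrable (fun x : E => Real.exp (-(‖y - x‖ ^ 2 / 8))) μ :=
    (integrable_exp_neg_norm_sq E μ).comp_sub_left y
  have hIy : ∫ x : E, Real.exp (-(‖y - x‖ ^ 2 / 8)) ∂μ = I := by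
    rw [hI, integral_sub_left_eq_self (fun x : E => Real.exp (-(‖x‖ ^ 2 / 8)))]
  -- Each term is compared with an integral over a ball of radius `1/2`; separation makes these
  -- balls disjoint. Halving the exponent from `1/4` to `1/8` pays for moving the centre `f a` to
  -- `x`.
  have hterm : ∀ a ∈ A, Real.exp (-(‖y - f a‖ ^ 2 / 4)) * m ≤
      ∫ x in Metric.ball (f a) (1 / 2), Real.exp 1 * Real.exp (-(‖y - x‖ ^ 2 / 8)) ∂μ := by
    intro a _
    have hma : μ.real (Metric.ball (f a) (1 / 2)) = m := by
      rw [hm, measureReal_def, measureReal_def, Measure.addHaar_ball_center]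
    rw [← hma, mul_comm, ← smul_eq_mul, ← setIntegral_const]
    refine setIntegral_mono_on ?_ (hint.const_mul _).integrableOn measurableSet_ball ?_
    · exact integrableOn_const measure_ball_lt_top.ne
    · intro x hx
      rw [← Real.exp_add]
      apply Real.exp_le_exp.2
      have h1 : ‖x - f a‖ < 1 / 2 := by simpa [dist_eq_norm] using hx
      have h2 : ‖y - x‖ ≤ ‖y - f a‖ + ‖x - f a‖ := by
        have := norm_sub_le (y - f a) (x - f a)
        simpa using this
      nlinarith [norm_nonneg (y - x), norm_nonneg (x - f a), norm_nonneg (y - f a),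
        sq_nonneg (‖y - f a‖ - ‖x - f a‖)]
  have hdisj : (A : Set ι).PairwiseDisjoint fun a => Metric.ball (f a) (1 / 2) := by
    intro a ha b hb hab
    refine Metric.ball_disjoint_ball ?_
    rw [dist_eq_norm]
    linarith [hf a ha b hb hab]
  calc (∑ a ∈ A, Real.exp (-(‖y - f a‖ ^ 2 / 4))) * m
      = ∑ a ∈ A, Real.exp (-(‖y - f a‖ ^ 2 / 4)) * m := Finset.sum_mul _ _ _
    _ ≤ ∑ a ∈ A, ∫ x in Metric.ball (f a) (1 / 2),
          Real.exp 1 * Real.exp (-(‖y - x‖ ^ 2 / 8)) ∂μ := Finset.sum_le_sum hterm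
    _ = ∫ x in ⋃ a ∈ A, Metric.ball (f a) (1 / 2),
          Real.exp 1 * Real.exp (-(‖y - x‖ ^ 2 / 8)) ∂μ :=
        (integral_biUnion_finset A (fun _ _ => measurableSet_ball) hdisj
          fun _ _ => (hint.const_mul _).integrableOn).symm
    _ ≤ ∫ x, Real.exp 1 * Real.exp (-(‖y - x‖ ^ 2 / 8)) ∂μ :=
        setIntegral_le_integral (hint.const_mul _)
          (Eventually.of_forall fun x => by positivity)
    _ = Real.exp 1 * I := by rw [integral_const_mul, hIy]

/-- Compact metric spaces have finite separated nets. -/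
theorem exists_finset_separated_net (X : Type*) [MetricSpace X] [CompactSpace X] {ρ : ℝ}
    (hρ : 0 < ρ) : ∃ A : Finset X, (∀ a ∈ A, ∀ b ∈ A, a ≠ b → ρ ≤ dist a b) ∧
      ∀ x, ∃ a ∈ A, dist x a ≤ ρ := by
  lift ρ to NNReal using hρ.le
  have hρ2 : ρ / 2 ≠ 0 := by simpa using (show (0 : ℝ) < ρ from hρ).ne'
  obtain ⟨N, -, hNf, hN⟩ := Metric.exists_finite_isCover_of_isCompact hρ2
    (isCompact_univ (X := X))
  have htop : Metric.packingNumber ρ (univ : Set X) ≠ ⊤ := by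
    have h1 := Metric.packingNumber_two_mul_le_externalCoveringNumber (ρ / 2) (univ : Set X)
    rw [mul_div_cancel₀ _ two_ne_zero] at h1
    exact ((h1.trans (hN.externalCoveringNumber_le_encard)).trans_lt hNf.encard_lt_top).ne
  have hfin : (Metric.maximalSeparatedSet ρ (univ : Set X)).Finite := by
    rw [← Set.encard_lt_top_iff, Metric.encard_maximalSeparatedSet htop]
    exact htop.lt_top
  refine ⟨hfin.toFinset, fun a ha b hb hab => ?_, fun x => ?_⟩
  · have := Metric.isSeparated_maximalSeparatedSet (hfin.mem_toFinset.1 ha)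
      (hfin.mem_toFinset.1 hb) hab
    simp only [edist_nndist] at this
    exact_mod_cast this.le
  · obtain ⟨a, ha, hxa⟩ := Metric.isCover_maximalSeparatedSet htop (mem_univ x)
    refine ⟨a, hfin.mem_toFinset.2 ha, ?_⟩
    simp only [mem_ofPred_eq, edist_nndist] at hxa
    exact_mod_cast hxa

/-! ### Choice of phases and expansion of the square root -/

/-- Phases can be chosen greedily so that a linear functional does not decrease and a quadratic
functional is at least half of its diagonal part. -/
theorem exists_phases {X ι : Type*} [TopologicalSpace X] [CompactSpace X] [MeasurableSpace X]
    [OpensMeasurableSpace X] (μ : Measure X) [IsFiniteMeasure μ] (A : Finset ι)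
    {P Q : X → ℝ} (hP : Continuous P) (hQ : Continuous Q)
    {g : ι → X → ℂ} (hg : ∀ a, Continuous (g a)) :
    ∃ e : ι → ℂ, (∀ a, ‖e a‖ = 1) ∧
      ∑ a ∈ A, (1 / 2) * ∫ x, Q x * ‖g a x‖ ^ 2 ∂μ ≤
        ∫ x, (P x * (∑ a ∈ A, e a * g a x).re + Q x * (∑ a ∈ A, e a * g a x).re ^ 2) ∂μ := by
  classical
  have int : ∀ {f : X → ℝ}, Continuous f → Integrable f μ := fun hf =>
    hf.integrable_of_hasCompactSupport (HasCompactSupport.of_compactSpace _)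
  induction A using Finset.induction_on with
  | empty => exact ⟨fun _ => 1, by simp, by simp⟩
  | insert b A hb ih =>
    obtain ⟨e, he, hle⟩ := ih
    set q : X → ℝ := fun x => (∑ a ∈ A, e a * g a x).re with hq
    have hqc : Continuous q := by
      have : Continuous fun x => ∑ a ∈ A, e a * g a x :=
        continuous_finsetSum _ fun a _ => continuous_const.mul (hg a)
      exact Complex.continuous_re.comp this
    have key : ∀ c : ℂ, ∫ x, (P x * (c * g b x + ∑ a ∈ A, e a * g a x).re +
          Q x * (c * g b x + ∑ a ∈ A, e a * g a x).re ^ 2) ∂μ =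
        ∫ x, (P x * q x + Q x * q x ^ 2) ∂μ +
          ∫ x, (P x + 2 * Q x * q x) * (c * g b x).re ∂μ +
          ∫ x, Q x * (c * g b x).re ^ 2 ∂μ := by
      intro c
      have hc : Continuous fun x => (c * g b x).re :=
        Complex.continuous_re.comp (continuous_const.mul (hg b))
      rw [← integral_add (int (by fun_prop)) (int (by fun_prop)),
        ← integral_add (int (by fun_prop)) (int (by fun_prop))]
      refine integral_congr_ae (Eventually.of_forall fun x => ?_)
      simp only [hq, Complex.add_re]
      ring
    -- The squared real parts of `g` and `I * g` add up to `‖g‖ ^ 2`, so one of the phases `1`, `I`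
    -- captures at least half of the integral.
    obtain ⟨c, hc, hcQ⟩ : ∃ c : ℂ, ‖c‖ = 1 ∧
        (1 / 2) * ∫ x, Q x * ‖g b x‖ ^ 2 ∂μ ≤ ∫ x, Q x * (c * g b x).re ^ 2 ∂μ := by
      have hr : Continuous fun x => (g b x).re := Complex.continuous_re.comp (hg b)
      have hi : Continuous fun x => (g b x).im := Complex.continuous_im.comp (hg b)
      have hsum : ∫ x, Q x * ‖g b x‖ ^ 2 ∂μ =
          ∫ x, Q x * (g b x).re ^ 2 ∂μ + ∫ x, Q x * (g b x).im ^ 2 ∂μ := by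
        rw [← integral_add (int (by fun_prop)) (int (by fun_prop))]
        refine integral_congr_ae (Eventually.of_forall fun x => ?_)
        simp only [Complex.sq_norm, Complex.normSq_apply]
        ring
      rcases le_total (∫ x, Q x * (g b x).re ^ 2 ∂μ) (∫ x, Q x * (g b x).im ^ 2 ∂μ) with h | h
      · refine ⟨Complex.I, by simp, ?_⟩
        simp only [Complex.I_mul_re, neg_sq]
        linarith
      · refine ⟨1, by simp, ?_⟩
        simp only [one_mul]
        linarith
    -- A sign leaves the square unchanged and makes the term linear in the new summand nonnegative.
    obtain ⟨s, hs, hs0⟩ : ∃ s : ℝ, |s| = 1 ∧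
        0 ≤ s * ∫ x, (P x + 2 * Q x * q x) * (c * g b x).re ∂μ := by
      rcases le_total 0 (∫ x, (P x + 2 * Q x * q x) * (c * g b x).re ∂μ) with h | h
      · exact ⟨1, by simp, by simpa using h⟩
      · exact ⟨-1, by simp, by simpa using h⟩
    refine ⟨Function.update e b (s * c), fun a => ?_, ?_⟩
    · rcases eq_or_ne a b with rfl | h
      · simp [hs, hc]
      · simp [h, he]
    · have hsame : ∀ x, ∑ a ∈ A, Function.update e b (s * c) a * g a x =
          ∑ a ∈ A, e a * g a x := fun x => Finset.sum_congr rfl fun a ha => by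
        rw [Function.update_of_ne (by rintro rfl; exact hb ha)]
      simp only [Finset.sum_insert hb, hsame, Function.update_self, key]
      have h1 : ∫ x, (P x + 2 * Q x * q x) * (s * c * g b x).re ∂μ =
          s * ∫ x, (P x + 2 * Q x * q x) * (c * g b x).re ∂μ := by
        rw [← integral_const_mul]
        refine integral_congr_ae (Eventually.of_forall fun x => ?_)
        simp only [mul_assoc, Complex.re_ofReal_mul]
        ring
      have h2 : ∫ x, Q x * (s * c * g b x).re ^ 2 ∂μ = ∫ x, Q x * (c * g b x).re ^ 2 ∂μ := by
        refine integral_congr_ae (Eventually.of_forall fun x => ?_)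
        have : s ^ 2 = 1 := by rw [← sq_abs, hs, one_pow]
        simp only [mul_assoc, Complex.re_ofReal_mul, mul_pow, this, one_mul]
      rw [h1, h2]
      linarith

/-- The Taylor coefficient `1/8` is weakened to `1/16` so that the bound holds on the whole range
`|x| ≤ V`, not only for small `x`. -/
lemma sqrt_sub_le {V x : ℝ} (hV : 0 < V) (hx : |x| ≤ V) :
    √(V - x) ≤ √V - (1 / (2 * √V) * x + 1 / (16 * (V * √V)) * x ^ 2) := by
  obtain ⟨s, hs, rfl⟩ : ∃ s : ℝ, 0 < s ∧ V = s ^ 2 := ⟨√V, by positivity, by simp [hV.le]⟩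
  rw [Real.sqrt_sq hs.le]
  obtain ⟨y, rfl⟩ : ∃ y, x = s ^ 2 * y := ⟨x / s ^ 2, by field_simp⟩
  have hy : |y| ≤ 1 := by
    rw [abs_mul, abs_of_pos hV] at hx
    exact le_of_mul_le_mul_left (by simpa using hx) hV
  obtain ⟨h1, h2⟩ := abs_le.1 hy
  have e : s - (1 / (2 * s) * (s ^ 2 * y) + 1 / (16 * (s ^ 2 * s)) * (s ^ 2 * y) ^ 2) =
      s * (1 - y / 2 - y ^ 2 / 16) := by
    field_simp
    ring
  rw [e]
  refine Real.sqrt_le_iff.2 ⟨mul_nonneg hs.le (by nlinarith), ?_⟩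
  rw [mul_pow]
  have : 1 - y ≤ (1 - y / 2 - y ^ 2 / 16) ^ 2 := by nlinarith [sq_nonneg y, sq_nonneg (y ^ 2)]
  nlinarith

/-! ### Peak functions and the improvement step -/

namespace BallAdmissible

/-- The Gaussian peak function `z ↦ exp (N (⟨z, a⟩ - 1))`. -/
noncomputable def peak {E : Type*} [NormedAddCommGroup E] [InnerProductSpace ℂ E]
    (N : ℝ) (a z : E) : ℂ :=
  Complex.exp (N * (inner ℂ a z - 1))

lemma differentiable_peak {E : Type*} [NormedAddCommGroup E] [InnerProductSpace ℂ E]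
    (N : ℝ) (a : E) : Differentiable ℂ (peak N a) := by
  have : Differentiable ℂ fun z : E => inner ℂ a z := (innerSL ℂ a).differentiable
  unfold peak
  fun_prop

/-- Polarization: `2 Re ⟨z, a⟩ = 1 + ‖z‖² - ‖z - a‖²`. The first factor localizes near `a`; the
second is `1` on the sphere and decays with `N` inside the ball. -/
lemma norm_peak {E : Type*} [NormedAddCommGroup E] [InnerProductSpace ℂ E]
    (N : ℝ) {a : E} (ha : ‖a‖ = 1) (z : E) :
    ‖peak N a z‖ = Real.exp (-(N * ‖z - a‖ ^ 2 / 2)) * Real.exp (-(N * (1 - ‖z‖ ^ 2) / 2)) := by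
  rw [peak, Complex.norm_exp, ← Real.exp_add, Complex.re_ofReal_mul]
  congr 1
  have h := norm_sub_sq (𝕜 := ℂ) z a
  rw [ha] at h
  have h2 : (inner ℂ a z).re = RCLike.re (inner ℂ z a) := inner_re_symm (𝕜 := ℂ) a z
  rw [Complex.sub_re, h2, h, Complex.one_re]
  ring

lemma exists_pos_le_of_continuous {X : Type*} [TopologicalSpace X] [CompactSpace X] {V : X → ℝ}
    (hV : Continuous V) (hpos : ∀ x, 0 < V x) :
    ∃ m M : ℝ, 0 < m ∧ 0 < M ∧ ∀ x, m ≤ V x ∧ V x ≤ M := by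
  -- The empty case does occur: it is the unit sphere for `n = 0`.
  rcases isEmpty_or_nonempty X with h | h
  · exact ⟨1, 1, one_pos, one_pos, fun x => h.elim x⟩
  · obtain ⟨x, -, hx⟩ := isCompact_univ.exists_isMinOn univ_nonempty hV.continuousOn
    obtain ⟨y, -, hy⟩ := isCompact_univ.exists_isMaxOn univ_nonempty hV.continuousOn
    exact ⟨V x, V y, hpos x, hpos y, fun z => ⟨hx (mem_univ z), hy (mem_univ z)⟩⟩

lemma tendsto_const_mul_exp_neg_mul (K : ℝ) {b : ℝ} (hb : 0 < b) :
    Tendsto (fun N : ℝ => K * Real.exp (-(N * b))) atTop (𝓝 0) := by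
  have h : Tendsto (fun N : ℝ => N * b) atTop atTop := tendsto_id.atTop_mul_const hb
  simpa using (Real.tendsto_exp_neg_atTop_nhds_zero.comp h).const_mul K

/-- One step of the approximation: a positive continuous function `V` on the sphere is improved to
the positive function `V - Re q`, where `q` is entire, small on a given ball, and dominated by `V`
on approach regions. -/
theorem exists_improving_function (n : ℕ)
    (μ : Measure (Metric.sphere (0 : EuclideanSpace ℂ (Fin n)) 1)) [IsFiniteMeasure μ] :
    ∃ c : ℝ, 0 < c ∧
      ∀ V : Metric.sphere (0 : EuclideanSpace ℂ (Fin n)) 1 → ℝ, Continuous V → (∀ x, 0 < V x) →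
      ∀ ε > 0, ∀ α > 0, ∀ r < 1, ∃ q : EuclideanSpace ℂ (Fin n) → ℂ, Differentiable ℂ q ∧
        (∀ ζ : Metric.sphere (0 : EuclideanSpace ℂ (Fin n)) 1, ‖q ζ‖ ≤ 3 / 4 * V ζ) ∧
        (∀ ζ : Metric.sphere (0 : EuclideanSpace ℂ (Fin n)) 1,
          ∀ z ∈ approachRegion α (ζ : EuclideanSpace ℂ (Fin n)), ‖q z‖ ≤ V ζ + ε) ∧
        (∀ z, ‖z‖ ≤ r → ‖q z‖ ≤ ε) ∧
        ∫ ζ, √(V ζ - (q ζ).re) ∂μ ≤ (1 - c) * ∫ ζ, √(V ζ) ∂μ := by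
  obtain ⟨C, hC1, hC⟩ := exists_gaussian_sum_le (EuclideanSpace ℂ (Fin n)) volume
  have hC0 : 0 < C := by linarith
  set κ : ℝ := 1 / (4 * C) with hκ
  have hκ0 : 0 < κ := by positivity
  have hκC : κ * C = 1 / 4 := by rw [hκ]; field_simp
  -- `128 = 2 * 16 * 4`: the half from the phases, the `1/16` of `sqrt_sub_le`, and `(V x / 2) ^ 2`.
  -- The factor `exp (-1)` bounds the squared peak at distance at most `1/√N`.
  refine ⟨κ ^ 2 * Real.exp (-1) / 128, by positivity, ?_⟩
  intro V hVc hV ε hε α hα r hr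
  obtain ⟨m, M, hm, hM, hmM⟩ := exists_pos_le_of_continuous hVc hV
  obtain ⟨δ, hδ, hVδ⟩ := Metric.uniformContinuous_iff.1
    (CompactSpace.uniformContinuous_of_continuous hVc) (m / 2) (by positivity)
  have hnear : ∀ x y, dist x y < δ → V x ≤ 3 / 2 * V y ∧ V y / 2 ≤ V x := by
    intro x y hxy
    have h := abs_lt.1 (Real.dist_eq _ _ ▸ hVδ hxy)
    have := (hmM y).1
    constructor <;> linarith [h.1, h.2]
  -- A point of an approach region of aperture `α` farther than `δ / 2` from `ζ` has `1 - ‖z‖ > δ /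
  -- (2 * α)`, hence lies in the ball of radius `r'`.
  set r' : ℝ := max r (1 - δ / (2 * α)) with hr'
  have hr'1 : 0 < 1 - r' := by
    have : 0 < δ / (2 * α) := by positivity
    rw [sub_pos, hr', max_lt_iff]
    exact ⟨hr, by linarith⟩
  -- Large `N` makes the net finer than the scale `δ` on which `V` is nearly constant, the peaks at
  -- distance `δ / 2` negligible against `m ≤ V`, and all peaks small on the ball of radius `r'`.
  obtain ⟨N, hN0, hNδ, hN1, hN2⟩ : ∃ N : ℝ, 0 < N ∧ 1 / √N < δ ∧
      M * Real.exp (-(N * (δ ^ 2 / 16))) ≤ m ∧ M * Real.exp (-(N * ((1 - r') / 2))) ≤ ε := by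
    have e1 := (tendsto_const_mul_exp_neg_mul M
      (show 0 < δ ^ 2 / 16 by positivity)).eventually_le_const hm
    have e2 := (tendsto_const_mul_exp_neg_mul M
      (show 0 < (1 - r') / 2 by positivity)).eventually_le_const hε
    have e3 : Tendsto (fun N : ℝ => 1 / √N) atTop (𝓝 0) := by
      simp only [one_div]
      exact Real.tendsto_sqrt_atTop.inv_tendsto_atTop
    obtain ⟨N, h⟩ := ((eventually_gt_atTop 0).and ((e3.eventually_lt_const hδ).and
      (e1.and e2))).exists
    exact ⟨N, h.1, h.2.1, h.2.2.1, h.2.2.2⟩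
  have hsN : 0 < √N := Real.sqrt_pos.2 hN0
  have hsN2 : √N ^ 2 = N := Real.sq_sqrt hN0.le
  obtain ⟨A, hAsep, hAnet⟩ := exists_finset_separated_net
    (Metric.sphere (0 : EuclideanSpace ℂ (Fin n)) 1) (show 0 < 1 / √N by positivity)
  have hsum : ∀ z : EuclideanSpace ℂ (Fin n),
      ∑ a ∈ A, Real.exp (-(N * ‖z - a‖ ^ 2 / 4)) ≤ C := by
    intro z
    have := hC A (fun a => √N • (a : EuclideanSpace ℂ (Fin n))) (fun a ha b hb hab => by
      rw [← smul_sub, norm_smul, Real.norm_of_nonneg hsN.le, ← dist_eq_norm]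
      have := hAsep a ha b hb hab
      rw [div_le_iff₀ hsN] at this
      rw [mul_comm]
      exact this) (√N • z)
    simpa only [← smul_sub, norm_smul, Real.norm_of_nonneg hsN.le, mul_pow, hsN2] using this
  have hnorm1 : ∀ a : Metric.sphere (0 : EuclideanSpace ℂ (Fin n)) 1,
      ‖(a : EuclideanSpace ℂ (Fin n))‖ = 1 := fun a => by simp
  set g : Metric.sphere (0 : EuclideanSpace ℂ (Fin n)) 1 → EuclideanSpace ℂ (Fin n) → ℂ :=
    fun a z => (κ * V a : ℝ) * peak N (a : EuclideanSpace ℂ (Fin n)) z with hg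
  have hgd : ∀ a, Differentiable ℂ (g a) := fun a => (differentiable_peak N _).const_mul _
  have hgn : ∀ a z, ‖g a z‖ = κ * V a * (Real.exp (-(N * ‖z - a‖ ^ 2 / 2)) *
      Real.exp (-(N * (1 - ‖z‖ ^ 2) / 2))) := by
    intro a z
    rw [hg]
    simp only
    rw [norm_mul, Complex.norm_real, Real.norm_of_nonneg (mul_pos hκ0 (hV a)).le,
      norm_peak N (hnorm1 a)]
  have hsq : ∀ s : ℝ, Real.exp (-(N * s ^ 2 / 2)) ≤ Real.exp (-(N * s ^ 2 / 4)) := fun s =>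
    Real.exp_le_exp.2 (by nlinarith [sq_nonneg s])
  -- Peaks near `z` have `V a` comparable to `V ζ`; for far ones, half of the Gaussian exponent
  -- absorbs `V a`. The other half is summed with `hsum`, giving `5/2 * κ * C = 5/8 ≤ 3/4`.
  have hnear_sum : ∀ (ζ : Metric.sphere (0 : EuclideanSpace ℂ (Fin n)) 1)
      (z : EuclideanSpace ℂ (Fin n)), ‖z‖ ≤ 1 → ‖z - ζ‖ ≤ δ / 2 →
      ∑ a ∈ A, ‖g a z‖ ≤ 3 / 4 * V ζ := by
    intro ζ z hz hzζ
    have hterm : ∀ a ∈ A, ‖g a z‖ ≤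
        κ * (5 / 2 * V ζ) * Real.exp (-(N * ‖z - a‖ ^ 2 / 4)) := by
      intro a _
      have h1 : Real.exp (-(N * (1 - ‖z‖ ^ 2) / 2)) ≤ 1 := by
        refine Real.exp_le_one_iff.2 ?_
        have : 0 ≤ 1 - ‖z‖ ^ 2 := by nlinarith [norm_nonneg z]
        have := mul_nonneg hN0.le this
        linarith
      rw [hgn, mul_assoc, mul_assoc]
      refine mul_le_mul_of_nonneg_left ?_ hκ0.le
      have h2 : V a * Real.exp (-(N * ‖z - a‖ ^ 2 / 2)) ≤
          5 / 2 * V ζ * Real.exp (-(N * ‖z - a‖ ^ 2 / 4)) := by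
        rcases lt_or_ge ‖z - a‖ (δ / 2) with h | h
        · have hd : dist a ζ < δ := by
            rw [Subtype.dist_eq, dist_eq_norm]
            calc ‖(a : EuclideanSpace ℂ (Fin n)) - ζ‖ = ‖(z - ζ) - (z - a)‖ := by
                  congr 1; abel
              _ ≤ ‖z - ζ‖ + ‖z - a‖ := norm_sub_le _ _
              _ < δ := by linarith
          have := (hnear a ζ hd).1
          have hVζ := hV ζ
          exact mul_le_mul (by linarith) (hsq _) (Real.exp_nonneg _) (by linarith)
        · have hsplit : Real.exp (-(N * ‖z - a‖ ^ 2 / 2)) ≤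
              Real.exp (-(N * (δ ^ 2 / 16))) * Real.exp (-(N * ‖z - a‖ ^ 2 / 4)) := by
            rw [← Real.exp_add]
            refine Real.exp_le_exp.2 ?_
            have : (δ / 2) ^ 2 ≤ ‖z - a‖ ^ 2 := by gcongr
            nlinarith
          calc V a * Real.exp (-(N * ‖z - a‖ ^ 2 / 2))
              ≤ M * (Real.exp (-(N * (δ ^ 2 / 16))) * Real.exp (-(N * ‖z - a‖ ^ 2 / 4))) :=
                mul_le_mul (hmM a).2 hsplit (Real.exp_nonneg _) hM.le
            _ = (M * Real.exp (-(N * (δ ^ 2 / 16)))) * Real.exp (-(N * ‖z - a‖ ^ 2 / 4)) := by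
                ring
            _ ≤ 5 / 2 * V ζ * Real.exp (-(N * ‖z - a‖ ^ 2 / 4)) := by
                refine mul_le_mul_of_nonneg_right ?_ (Real.exp_nonneg _)
                linarith [(hmM ζ).1]
      rw [← mul_assoc]
      exact (mul_le_of_le_one_right (mul_nonneg (hV a).le (Real.exp_nonneg _)) h1).trans h2
    calc ∑ a ∈ A, ‖g a z‖ ≤ ∑ a ∈ A, κ * (5 / 2 * V ζ) * Real.exp (-(N * ‖z - a‖ ^ 2 / 4)) :=
          Finset.sum_le_sum hterm
      _ = κ * (5 / 2 * V ζ) * ∑ a ∈ A, Real.exp (-(N * ‖z - a‖ ^ 2 / 4)) := by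
          rw [Finset.mul_sum]
      _ ≤ κ * (5 / 2 * V ζ) * C := by
          have := hV ζ
          exact mul_le_mul_of_nonneg_left (hsum z) (by positivity)
      _ = 5 / 2 * V ζ * (κ * C) := by ring
      _ ≤ 3 / 4 * V ζ := by rw [hκC]; linarith [hV ζ]
  have hball_sum : ∀ z : EuclideanSpace ℂ (Fin n), ‖z‖ ≤ r' → ∑ a ∈ A, ‖g a z‖ ≤ ε := by
    intro z hz
    have hterm : ∀ a ∈ A, ‖g a z‖ ≤ κ * ε * Real.exp (-(N * ‖z - a‖ ^ 2 / 4)) := by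
      intro a _
      have h1 : Real.exp (-(N * (1 - ‖z‖ ^ 2) / 2)) ≤ Real.exp (-(N * ((1 - r') / 2))) := by
        refine Real.exp_le_exp.2 ?_
        have h0 := norm_nonneg z
        have : 1 - r' ≤ 1 - ‖z‖ ^ 2 := by nlinarith
        have := mul_le_mul_of_nonneg_left this hN0.le
        linarith
      rw [hgn, mul_assoc, mul_assoc]
      refine mul_le_mul_of_nonneg_left ?_ hκ0.le
      calc V a * (Real.exp (-(N * ‖z - a‖ ^ 2 / 2)) * Real.exp (-(N * (1 - ‖z‖ ^ 2) / 2)))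
          ≤ M * (Real.exp (-(N * ‖z - a‖ ^ 2 / 4)) * Real.exp (-(N * ((1 - r') / 2)))) :=
            mul_le_mul (hmM a).2 (mul_le_mul (hsq _) h1 (Real.exp_nonneg _) (Real.exp_nonneg _))
              (by positivity) hM.le
        _ = (M * Real.exp (-(N * ((1 - r') / 2)))) * Real.exp (-(N * ‖z - a‖ ^ 2 / 4)) := by ring
        _ ≤ ε * Real.exp (-(N * ‖z - a‖ ^ 2 / 4)) :=
            mul_le_mul_of_nonneg_right hN2 (Real.exp_nonneg _)
    calc ∑ a ∈ A, ‖g a z‖ ≤ ∑ a ∈ A, κ * ε * Real.exp (-(N * ‖z - a‖ ^ 2 / 4)) :=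
          Finset.sum_le_sum hterm
      _ = κ * ε * ∑ a ∈ A, Real.exp (-(N * ‖z - a‖ ^ 2 / 4)) := by rw [Finset.mul_sum]
      _ ≤ κ * ε * C := mul_le_mul_of_nonneg_left (hsum z) (by positivity)
      _ = ε * (κ * C) := by ring
      _ ≤ ε := by rw [hκC]; linarith
  have hsV : Continuous fun x => √(V x) := hVc.sqrt
  have hsV0 : ∀ x, 0 < √(V x) := fun x => Real.sqrt_pos.2 (hV x)
  have hPc : Continuous fun x => 1 / (2 * √(V x)) :=
    continuous_const.div (by fun_prop) fun x => by have := hsV0 x; positivity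
  have hQc : Continuous fun x => 1 / (16 * (V x * √(V x))) :=
    continuous_const.div (by fun_prop) fun x => by have := hsV0 x; have := hV x; positivity
  have hgc : ∀ a, Continuous fun x : Metric.sphere (0 : EuclideanSpace ℂ (Fin n)) 1 => g a x :=
    fun a => (hgd a).continuous.comp continuous_subtype_val
  obtain ⟨e, he, hePQ⟩ := exists_phases μ A hPc hQc hgc
  set q : EuclideanSpace ℂ (Fin n) → ℂ := fun z => ∑ a ∈ A, e a * g a z with hq
  have hqd : Differentiable ℂ q := by
    rw [hq]
    exact Differentiable.fun_sum fun a _ => (hgd a).const_mul _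
  have hqn : ∀ z, ‖q z‖ ≤ ∑ a ∈ A, ‖g a z‖ := fun z =>
    (norm_sum_le _ _).trans_eq (Finset.sum_congr rfl fun a _ => by rw [norm_mul, he, one_mul])
  have hqS : ∀ ζ : Metric.sphere (0 : EuclideanSpace ℂ (Fin n)) 1, ‖q ζ‖ ≤ 3 / 4 * V ζ :=
    fun ζ => (hqn ζ).trans (hnear_sum ζ ζ (hnorm1 ζ).le (by simpa using (half_pos hδ).le))
  refine ⟨q, hqd, hqS, ?_, fun z hz => (hqn z).trans (hball_sum z (hz.trans (le_max_left _ _))), ?_⟩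
  · rintro ζ z ⟨hz1, hz2⟩
    rcases le_or_gt ‖z - ζ‖ (δ / 2) with h | h
    · have := (hqn z).trans (hnear_sum ζ z hz1.le h)
      linarith [hV ζ]
    · have : ‖z‖ ≤ r' := by
        refine le_max_of_le_right ?_
        have h3 : δ / (2 * α) ≤ 1 - ‖z‖ := by
          rw [div_le_iff₀ (by positivity)]
          linarith
        linarith
      linarith [(hqn z).trans (hball_sum z this), hV ζ]
  · have int : ∀ {f : Metric.sphere (0 : EuclideanSpace ℂ (Fin n)) 1 → ℝ},
        Continuous f → Integrable f μ := fun hf =>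
      hf.integrable_of_hasCompactSupport (HasCompactSupport.of_compactSpace _)
    have hqc : Continuous fun x : Metric.sphere (0 : EuclideanSpace ℂ (Fin n)) 1 => (q x).re :=
      Complex.continuous_re.comp (hqd.continuous.comp continuous_subtype_val)
    have hQg : ∀ a, Continuous fun x : Metric.sphere (0 : EuclideanSpace ℂ (Fin n)) 1 =>
        1 / 2 * (1 / (16 * (V x * √(V x))) * ‖g a x‖ ^ 2) := fun a =>
      continuous_const.mul (hQc.mul ((hgc a).norm.pow 2))
    have hPQ : Continuous fun x : Metric.sphere (0 : EuclideanSpace ℂ (Fin n)) 1 =>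
        1 / (2 * √(V x)) * (q x).re + 1 / (16 * (V x * √(V x))) * (q x).re ^ 2 :=
      (hPc.mul hqc).add (hQc.mul (hqc.pow 2))
    -- A single net point within `1/√N` of `x` already supplies the lower bound for the diagonal
    -- sum.
    have hlow : ∀ x : Metric.sphere (0 : EuclideanSpace ℂ (Fin n)) 1,
        κ ^ 2 * Real.exp (-1) / 128 * √(V x) ≤
          ∑ a ∈ A, 1 / 2 * (1 / (16 * (V x * √(V x))) * ‖g a x‖ ^ 2) := by
      intro x
      obtain ⟨a, ha, hxa⟩ := hAnet x
      have hVa : V x / 2 ≤ V a := by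
        refine (hnear a x ?_).2
        rw [dist_comm]
        exact hxa.trans_lt hNδ
      have hpk : Real.exp (-1) ≤ Real.exp (-(N * ‖(x : EuclideanSpace ℂ (Fin n)) - a‖ ^ 2)) := by
        refine Real.exp_le_exp.2 ?_
        rw [Subtype.dist_eq, dist_eq_norm] at hxa
        have : ‖(x : EuclideanSpace ℂ (Fin n)) - a‖ ^ 2 ≤ (1 / √N) ^ 2 := by gcongr
        rw [div_pow, hsN2, one_pow, le_div_iff₀ hN0] at this
        linarith
      have hga : κ ^ 2 * (V x / 2) ^ 2 * Real.exp (-1) ≤ ‖g a x‖ ^ 2 := by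
        have : ‖g a x‖ ^ 2 = κ ^ 2 * V a ^ 2 *
            Real.exp (-(N * ‖(x : EuclideanSpace ℂ (Fin n)) - a‖ ^ 2)) := by
          rw [hgn, hnorm1]
          simp only [one_pow, sub_self, mul_zero, zero_div, neg_zero, Real.exp_zero, mul_one]
          rw [mul_pow, ← Real.exp_nat_mul]
          push_cast
          ring_nf
        rw [this]
        have := hV x
        gcongr
      have hVx := hV x
      have hs := hsV0 x
      refine le_trans ?_ (Finset.single_le_sum
        (f := fun a => 1 / 2 * (1 / (16 * (V x * √(V x))) * ‖g a x‖ ^ 2))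
        (fun b _ => by positivity) ha)
      have h4 : κ ^ 2 * Real.exp (-1) / 128 * √(V x) =
          1 / 2 * (1 / (16 * (V x * √(V x))) * (κ ^ 2 * (V x / 2) ^ 2 * Real.exp (-1))) := by
        field_simp
        rw [Real.sq_sqrt hVx.le]
        ring
      rw [h4]
      gcongr
    have hmain : ∫ x, κ ^ 2 * Real.exp (-1) / 128 * √(V x) ∂μ ≤
        ∑ a ∈ A, (1 / 2) * ∫ x, 1 / (16 * (V x * √(V x))) * ‖g a x‖ ^ 2 ∂μ := by
      simp only [← integral_const_mul]
      rw [← integral_finsetSum _ fun a _ => int (hQg a)]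
      exact integral_mono (int (continuous_const.mul hsV))
        (int (continuous_finsetSum _ fun a _ => hQg a)) hlow
    have hup : ∫ x, √(V x - (q x).re) ∂μ ≤ ∫ x, √(V x) ∂μ -
        ∫ x, (1 / (2 * √(V x)) * (q x).re + 1 / (16 * (V x * √(V x))) * (q x).re ^ 2) ∂μ := by
      rw [← integral_sub (int hsV) (int hPQ)]
      refine integral_mono (int (hVc.sub hqc).sqrt) (int (hsV.sub hPQ)) fun x => ?_
      refine sqrt_sub_le (hV x) ?_
      linarith [Complex.abs_re_le_norm (q x), hqS x, hV x]
    rw [integral_const_mul] at hmain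
    linarith

end BallAdmissible

/-! ### Summability and normal convergence -/

lemma summable_of_le_mul_add {a b : ℕ → ℝ} {c : ℝ} (hc : 0 < c) (ha : ∀ k, 0 ≤ a k)
    (hb : ∀ k, 0 ≤ b k) (hbs : Summable b) (h : ∀ k, a (k + 1) ≤ (1 - c) * a k + b k) :
    Summable a := by
  have key : ∀ K, c * ∑ k ∈ Finset.range K, a k + a K ≤ a 0 + ∑ k ∈ Finset.range K, b k := by
    intro K
    induction K with
    | zero => simp
    | succ K ih =>
      rw [Finset.sum_range_succ, Finset.sum_range_succ]
      linarith [h K]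
  refine summable_of_sum_range_le (c := (a 0 + ∑' k, b k) / c) ha fun K => ?_
  rw [le_div_iff₀ hc]
  have := hbs.sum_le_tsum (Finset.range K) fun k _ => hb k
  linarith [key K, ha K]

lemma ae_summable_of_summable_integral {X : Type*} [MeasurableSpace X] {μ : Measure X}
    {f : ℕ → X → ℝ} (hf : ∀ k, Integrable (f k) μ) (h0 : ∀ k x, 0 ≤ f k x)
    (hs : Summable fun k => ∫ x, f k x ∂μ) : ∀ᵐ x ∂μ, Summable fun k => f k x := by
  have h1 : ∫⁻ x, ∑' k, ENNReal.ofReal (f k x) ∂μ ≠ ⊤ := by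
    rw [lintegral_tsum fun k => (hf k).aemeasurable.ennreal_ofReal]
    simp only [← fun k => ofReal_integral_eq_lintegral_ofReal (hf k)
      (Eventually.of_forall (h0 k))]
    exact hs.tsum_ofReal_ne_top
  filter_upwards [ae_lt_top' (AEMeasurable.tsum
    fun k => (hf k).aemeasurable.ennreal_ofReal) h1] with x hx
  have := ENNReal.summable_toReal hx.ne
  simpa only [ENNReal.toReal_ofReal (h0 _ x)] using this

/-- Eventually `√(a k) ≤ 1`, and then `a k ≤ √(a k)`. -/
lemma Summable.of_summable_sqrt {a : ℕ → ℝ} (ha : ∀ k, 0 ≤ a k) (h : Summable fun k => √(a k)) :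
    Summable a := by
  refine .of_norm_bounded_eventually_nat h ?_
  filter_upwards [h.tendsto_atTop_zero.eventually_le_const one_pos] with k hk
  rw [Real.norm_of_nonneg (ha k)]
  nlinarith [Real.sq_sqrt (ha k), Real.sqrt_nonneg (a k)]

lemma Real.sqrt_add_le_sqrt_add_sqrt {a b : ℝ} (ha : 0 ≤ a) (hb : 0 ≤ b) :
    √(a + b) ≤ √a + √b := by
  refine Real.sqrt_le_iff.2 ⟨by positivity, ?_⟩
  nlinarith [Real.sq_sqrt ha, Real.sq_sqrt hb, Real.sqrt_nonneg a, Real.sqrt_nonneg b,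
    mul_nonneg (Real.sqrt_nonneg a) (Real.sqrt_nonneg b)]

/-- A series of entire functions converging normally on compact subsets of the unit ball is
holomorphic there. -/
theorem differentiableOn_tsum_ball {E : Type*} [NormedAddCommGroup E] [NormedSpace ℂ E]
    {q : ℕ → E → ℂ} {u r : ℕ → ℝ} (hq : ∀ k, Differentiable ℂ (q k)) (hu : Summable u)
    (hr : Tendsto r atTop (𝓝 1)) (h : ∀ k z, ‖z‖ ≤ r k → ‖q k z‖ ≤ u k) :
    DifferentiableOn ℂ (fun z => ∑' k, q k z) (Metric.ball 0 1) := by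
  intro z₀ hz₀
  rw [mem_ball_zero_iff] at hz₀
  obtain ⟨s, hs0, hs1⟩ := exists_between hz₀
  obtain ⟨R, hsR, hR1⟩ := exists_between hs1
  obtain ⟨J, hJ⟩ := eventually_atTop.1 ((hr.eventually (lt_mem_nhds hR1)).mono
    fun _ => le_of_lt)
  have hsum : ∀ z ∈ Metric.ball (0 : E) s, Summable fun k => q k z := by
    intro z hz
    refine .of_norm_bounded_eventually_nat hu ?_
    filter_upwards [eventually_ge_atTop J] with k hk
    exact h k z (((mem_ball_zero_iff.1 hz).le.trans hsR.le).trans (hJ k hk))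
  -- Cauchy-type estimate on the ball of radius `R - s` about `z`, where `q` varies by at most `2 *
  -- u`. Only the tail from `J` on is bounded on the ball of radius `R`; the first `J` terms are
  -- added back at the end.
  have hfd : ∀ k, ∀ z ∈ Metric.ball (0 : E) s,
      ‖fderiv ℂ (q (k + J)) z‖ ≤ 2 * u (k + J) / (R - s) := by
    intro k z hz
    have hk : R ≤ r (k + J) := hJ _ (Nat.le_add_left _ _)
    rw [mem_ball_zero_iff] at hz
    refine Complex.norm_fderiv_le_div_of_mapsTo_ball (hq _).differentiableOn ?_ (sub_pos.2 hsR)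
    intro y hy
    have hy' : ‖y‖ ≤ R := by
      have h1 : ‖y - z‖ < R - s := by simpa [dist_eq_norm] using hy
      have h2 := norm_add_le (y - z) z
      rw [sub_add_cancel] at h2
      linarith
    rw [mem_closedBall_iff_norm]
    have h1 := h (k + J) y (hy'.trans hk)
    have h2 := h (k + J) z ((hz.le.trans hsR.le).trans hk)
    linarith [norm_sub_le (q (k + J) y) (q (k + J) z)]
  have hz₀s : z₀ ∈ Metric.ball (0 : E) s := mem_ball_zero_iff.2 hs0
  have hu' : Summable fun k => 2 * u (k + J) / (R - s) :=
    (((summable_nat_add_iff J).2 hu).mul_left 2).div_const _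
  let _ : NormedSpace ℝ E := NormedSpace.restrictScalars ℝ ℂ E
  have htail : HasFDerivAt (fun z => ∑' k, q (k + J) z) (∑' k, fderiv ℂ (q (k + J)) z₀) z₀ :=
    hasFDerivAt_tsum_of_isPreconnected hu' Metric.isOpen_ball
      (convex_ball (0 : E) s).isPreconnected
      (fun k z _ => ((hq (k + J)).differentiableAt).hasFDerivAt) hfd hz₀s
      ((summable_nat_add_iff J).2 (hsum z₀ hz₀s)) hz₀s
  have hd : DifferentiableAt ℂ (fun z => ∑ k ∈ Finset.range J, q k z + ∑' k, q (k + J) z) z₀ :=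
    ((Differentiable.fun_sum fun k _ => hq k).differentiableAt).add htail.differentiableAt
  refine (hd.congr_of_eventuallyEq ?_).differentiableWithinAt
  filter_upwards [Metric.isOpen_ball.mem_nhds hz₀s] with z hz
  exact ((hsum z hz).sum_add_tsum_nat_add J).symm

namespace BallAdmissible

/-- Termwise passage to the nontangential limit. -/
theorem hasNontangentialLimit_tsum {n : ℕ} {q : ℕ → EuclideanSpace ℂ (Fin n) → ℂ} {u : ℕ → ℝ}
    (hq : ∀ k, Continuous (q k)) (hu : Summable u) {ζ : EuclideanSpace ℂ (Fin n)}
    (h : ∀ k : ℕ, ∀ z ∈ approachRegion (k + 1 : ℝ) ζ, ‖q k z‖ ≤ u k) :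
    HasNontangentialLimit (fun z => ∑' k, q k z) ζ (∑' k, q k ζ) := by
  intro α _
  obtain ⟨J, hJ⟩ := exists_nat_ge α
  -- Only for `k ≥ J ≥ α` does the region of aperture `k + 1` contain that of aperture `α`. The
  -- finitely many earlier terms are bounded near `ζ` by continuity.
  have hb : Summable fun k => if k < J then ‖q k ζ‖ + 1 else u k := by
    refine .of_norm_bounded_eventually_nat hu.norm ?_
    filter_upwards [eventually_ge_atTop J] with k hk
    rw [if_neg (not_lt.2 hk)]
  refine tendsto_tsum_of_dominated_convergence hb
    (fun k => ((hq k).tendsto ζ).mono_left nhdsWithin_le_nhds) ?_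
  have h1 : ∀ᶠ z in 𝓝[approachRegion α ζ] ζ, ∀ k ∈ Finset.range J, ‖q k z‖ ≤ ‖q k ζ‖ + 1 := by
    refine (eventually_all_finset _).2 fun k _ => ?_
    exact ((((hq k).norm.tendsto ζ).mono_left nhdsWithin_le_nhds).eventually_le_const
      (lt_add_one _))
  filter_upwards [h1, self_mem_nhdsWithin] with z hz1 hz2 k
  split_ifs with hk
  · exact hz1 k (Finset.mem_range.2 hk)
  · refine h k z ⟨hz2.1, hz2.2.trans_le ?_⟩
    have hkJ : (J : ℝ) ≤ k := by exact_mod_cast not_lt.1 hk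
    exact mul_le_mul_of_nonneg_right (by linarith) (by linarith [hz2.1])

/-! ### Iteration of the improvement step -/

/-- An increasing sequence of positive continuous functions on the sphere which converges fast in
`L^{1/2}` is matched by a sequence of entire functions. -/
theorem exists_entire_sequence (n : ℕ)
    (μ : Measure (Metric.sphere (0 : EuclideanSpace ℂ (Fin n)) 1)) [IsFiniteMeasure μ]
    {v : ℕ → Metric.sphere (0 : EuclideanSpace ℂ (Fin n)) 1 → ℝ} (hv : ∀ k, Continuous (v k))
    (hv0 : ∀ x, 0 < v 0 x) (hmono : ∀ k x, v k x ≤ v (k + 1) x)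
    (hvs : Summable fun k => ∫ x, √(v (k + 1) x - v k x) ∂μ) :
    ∃ (q : ℕ → EuclideanSpace ℂ (Fin n) → ℂ)
      (V : ℕ → Metric.sphere (0 : EuclideanSpace ℂ (Fin n)) 1 → ℝ),
      (∀ k, Differentiable ℂ (q k)) ∧
      (∀ k (x : Metric.sphere (0 : EuclideanSpace ℂ (Fin n)) 1),
        V k x = v k x - (∑ j ∈ Finset.range k, q j x).re) ∧
      (∀ (k : ℕ) (z : EuclideanSpace ℂ (Fin n)), ‖z‖ ≤ 1 - 1 / ((k : ℝ) + 1) →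
        ‖q k z‖ ≤ (1 / 2 : ℝ) ^ k) ∧
      (∀ k (x : Metric.sphere (0 : EuclideanSpace ℂ (Fin n)) 1), ‖q k x‖ ≤ V k x) ∧
      (∀ (k : ℕ) (x : Metric.sphere (0 : EuclideanSpace ℂ (Fin n)) 1),
        ∀ z ∈ approachRegion (k + 1 : ℝ) (x : EuclideanSpace ℂ (Fin n)),
          ‖q k z‖ ≤ V k x + (1 / 2 : ℝ) ^ k) ∧
      ∀ᵐ x ∂μ, Summable fun k => V k x := by
  obtain ⟨c, hc0, hstep⟩ := exists_improving_function n μ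
  -- The state of the recursion: a partial sum together with positivity of its residual, which the
  -- next improvement needs.
  let S : ℕ → Type := fun k => {F : EuclideanSpace ℂ (Fin n) → ℂ //
    Differentiable ℂ F ∧ ∀ x : Metric.sphere (0 : EuclideanSpace ℂ (Fin n)) 1,
      0 < v k x - (F x).re}
  have hcont : ∀ k (F : S k), Continuous
      fun x : Metric.sphere (0 : EuclideanSpace ℂ (Fin n)) 1 => v k x - (F.1 x).re := fun k F =>
    (hv k).sub (Complex.continuous_re.comp (F.2.1.continuous.comp continuous_subtype_val))
  choose p hpd hpS hpA hpB hpI using fun (k : ℕ) (F : S k) =>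
    hstep (fun x => v k x - (F.1 x).re) (hcont k F) F.2.2 ((1 / 2 : ℝ) ^ k) (by positivity)
      (k + 1 : ℝ) (by positivity) (1 - 1 / ((k : ℝ) + 1)) (sub_lt_self _ (by positivity))
  have hpos : ∀ k (F : S k) (x : Metric.sphere (0 : EuclideanSpace ℂ (Fin n)) 1),
      0 < v k x - (F.1 x).re - (p k F x).re := fun k F x => by
    linarith [hpS k F x, F.2.2 x, Complex.re_le_norm (p k F x)]
  let next : ∀ k, S k → S (k + 1) := fun k F => ⟨fun z => F.1 z + p k F z,
    F.2.1.add (hpd k F), fun x => by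
      rw [Complex.add_re]
      linarith [hpos k F x, hmono k x]⟩
  let F : ∀ k, S k := fun k => Nat.rec ⟨fun _ => 0, differentiable_const _, by simpa using hv0⟩
    next k
  have hF : ∀ k z, (F k).1 z = ∑ j ∈ Finset.range k, p j (F j) z := by
    intro k z
    induction k with
    | zero => simp [F]
    | succ k ih => rw [Finset.sum_range_succ, ← ih]
  refine ⟨fun k => p k (F k), fun k x => v k x - ((F k).1 x).re, fun k => hpd k _,
    fun k x => by simp only [hF], fun k => hpB k _,
    fun k x => ?_, fun k => hpA k _, ?_⟩
  · linarith [hpS k (F k) x, (F k).2.2 x]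
  · have int : ∀ {f : Metric.sphere (0 : EuclideanSpace ℂ (Fin n)) 1 → ℝ},
        Continuous f → Integrable f μ := fun hf =>
      hf.integrable_of_hasCompactSupport (HasCompactSupport.of_compactSpace _)
    have hsum : Summable fun k => ∫ x, √(v k x - ((F k).1 x).re) ∂μ := by
      refine summable_of_le_mul_add hc0 (fun k => integral_nonneg fun x => Real.sqrt_nonneg _)
        (fun k => integral_nonneg fun x => Real.sqrt_nonneg _) hvs fun k => ?_
      -- Passing from `v k` to `v (k + 1)` adds the increment to the residual; subadditivity of the
      -- square root keeps its cost separate.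
      refine le_trans ?_ (add_le_add_left (hpI k (F k)) _)
      have h1 : Continuous fun x : Metric.sphere (0 : EuclideanSpace ℂ (Fin n)) 1 =>
          √(v k x - ((F k).1 x).re - (p k (F k) x).re) :=
        ((hcont k (F k)).sub (Complex.continuous_re.comp
          ((hpd k (F k)).continuous.comp continuous_subtype_val))).sqrt
      have h2 : Continuous fun x => √(v (k + 1) x - v k x) := ((hv _).sub (hv _)).sqrt
      rw [← integral_add (int h1) (int h2)]
      refine integral_mono (int (hcont (k + 1) (F (k + 1))).sqrt) (int (h1.add h2)) fun x => ?_
      have h3 : v (k + 1) x - ((F (k + 1)).1 x).re =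
          (v k x - ((F k).1 x).re - (p k (F k) x).re) + (v (k + 1) x - v k x) := by
        have : (F (k + 1)).1 x = (F k).1 x + p k (F k) x := rfl
        rw [this, Complex.add_re]
        ring
      simp only [h3]
      exact Real.sqrt_add_le_sqrt_add_sqrt (hpos k (F k) x).le (sub_nonneg.2 (hmono k x))
    filter_upwards [ae_summable_of_summable_integral (fun k => int (hcont k (F k)).sqrt)
      (fun k x => Real.sqrt_nonneg _) hsum] with x hx
    exact Summable.of_summable_sqrt (fun k => ((F k).2.2 x).le) hx

/-- The limit of an increasing sequence of positive continuous functions which converges fast in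
`L^{1/2}` is almost everywhere the real part of the nontangential limit of a holomorphic
function. -/
theorem exists_holomorphic_re_limit (n : ℕ)
    (μ : Measure (Metric.sphere (0 : EuclideanSpace ℂ (Fin n)) 1)) [IsFiniteMeasure μ]
    {v : ℕ → Metric.sphere (0 : EuclideanSpace ℂ (Fin n)) 1 → ℝ} (hv : ∀ k, Continuous (v k))
    (hv0 : ∀ x, 0 < v 0 x) (hmono : ∀ k x, v k x ≤ v (k + 1) x)
    (hvs : Summable fun k => ∫ x, √(v (k + 1) x - v k x) ∂μ) :
    ∃ F : EuclideanSpace ℂ (Fin n) → ℂ, DifferentiableOn ℂ F (Metric.ball 0 1) ∧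
      ∀ᵐ x : Metric.sphere (0 : EuclideanSpace ℂ (Fin n)) 1 ∂μ, ∃ L : ℂ,
        HasNontangentialLimit F (x : EuclideanSpace ℂ (Fin n)) L ∧
        Tendsto (fun k => v k x) atTop (𝓝 L.re) := by
  obtain ⟨q, V, hqd, hVq, hqB, hqS, hqA, hVs⟩ := exists_entire_sequence n μ hv hv0 hmono hvs
  have hgeo : Summable fun k : ℕ => (1 / 2 : ℝ) ^ k := summable_geometric_two
  refine ⟨fun z => ∑' k, q k z, differentiableOn_tsum_ball hqd hgeo ?_ hqB, ?_⟩
  · simpa using (tendsto_const_nhds (x := (1 : ℝ))).sub tendsto_one_div_add_atTop_nhds_zero_nat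
  · filter_upwards [hVs] with x hx
    refine ⟨_, hasNontangentialLimit_tsum (fun k => (hqd k).continuous) (hx.add hgeo)
      (fun k => hqA k x), ?_⟩
    have hs : Summable fun k => q k x := .of_norm_bounded hx fun k => hqS k x
    have h1 := (Complex.continuous_re.tendsto _).comp hs.hasSum.tendsto_sum_nat
    -- The residuals tend to zero, so `v k` and the real parts of the partial sums have the same
    -- limit.
    have h2 := hx.tendsto_atTop_zero.add h1
    rw [zero_add] at h2
    refine h2.congr fun k => ?_
    simp [hVq]

end BallAdmissible

/-! ### Unitary maps on the sphere -/

namespace BallAdmissible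

/-- A unitary matrix as a linear isometry of `ℂⁿ`. -/
noncomputable def unitaryIsometry {n : ℕ} (τ : Matrix.unitaryGroup (Fin n) ℂ) :
    EuclideanSpace ℂ (Fin n) →ₗᵢ[ℂ] EuclideanSpace ℂ (Fin n) where
  toLinearMap := Matrix.toEuclideanLin (τ : Matrix (Fin n) (Fin n) ℂ)
  norm_map' z := by
    have h : (Matrix.conjTranspose (τ : Matrix (Fin n) (Fin n) ℂ)) * τ = 1 :=
      (Matrix.mem_unitaryGroup_iff').1 τ.2
    have h2 : Matrix.toEuclideanLin (Matrix.conjTranspose (τ : Matrix (Fin n) (Fin n) ℂ))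
        (Matrix.toEuclideanLin (τ : Matrix (Fin n) (Fin n) ℂ) z) = z := by
      simp [Matrix.toLpLin_apply, Matrix.mulVec_mulVec, h]
    have h3 : inner ℂ (Matrix.toEuclideanLin (τ : Matrix (Fin n) (Fin n) ℂ) z)
        (Matrix.toEuclideanLin (τ : Matrix (Fin n) (Fin n) ℂ) z) = inner ℂ z z := by
      rw [← LinearMap.adjoint_inner_right, ← Matrix.toEuclideanLin_conjTranspose_eq_adjoint, h2]
    rw [inner_self_eq_norm_sq_to_K, inner_self_eq_norm_sq_to_K] at h3
    have h4 : ‖Matrix.toEuclideanLin (τ : Matrix (Fin n) (Fin n) ℂ) z‖ ^ 2 = ‖z‖ ^ 2 := by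
      exact_mod_cast h3
    exact (sq_eq_sq₀ (norm_nonneg _) (norm_nonneg _)).1 h4

lemma unitaryIsometry_apply {n : ℕ} (τ : Matrix.unitaryGroup (Fin n) ℂ)
    (z : EuclideanSpace ℂ (Fin n)) :
    unitaryIsometry τ z = Matrix.toEuclideanLin (τ : Matrix (Fin n) (Fin n) ℂ) z := rfl

lemma unitaryIsometry_mul {n : ℕ} (τ υ : Matrix.unitaryGroup (Fin n) ℂ)
    (z : EuclideanSpace ℂ (Fin n)) :
    unitaryIsometry (τ * υ) z = unitaryIsometry τ (unitaryIsometry υ z) := by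
  simp [unitaryIsometry_apply, Matrix.toLpLin_apply, Matrix.mulVec_mulVec]

/-- The restriction of a linear isometry to the unit sphere. -/
def sphereMap {E : Type*} [NormedAddCommGroup E] [NormedSpace ℂ E] (T : E →ₗᵢ[ℂ] E)
    (x : Metric.sphere (0 : E) 1) : Metric.sphere (0 : E) 1 :=
  ⟨T x, by rw [mem_sphere_zero_iff_norm, T.norm_map, norm_eq_of_mem_sphere]⟩

open scoped Pointwise in
/-- Unitary maps preserve the null sets of the surface measure. -/
theorem ae_sphereMap {n : ℕ}
    (T : EuclideanSpace ℂ (Fin n) →ₗᵢ[ℂ] EuclideanSpace ℂ (Fin n))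
    {p : Metric.sphere (0 : EuclideanSpace ℂ (Fin n)) 1 → Prop}
    (hp : ∀ᵐ x ∂(sphereMeasure n), p x) : ∀ᵐ x ∂(sphereMeasure n), p (sphereMap T x) := by
  have hcont : Continuous (sphereMap T) :=
    (T.continuous.comp continuous_subtype_val).subtype_mk _
  set e : EuclideanSpace ℂ (Fin n) ≃ₗ[ℝ] EuclideanSpace ℂ (Fin n) :=
    (T.toLinearIsometryEquiv rfl).toLinearEquiv.restrictScalars ℝ with he
  have heT : ∀ z, e z = T z := fun z => by
    rw [he]
    simp
  -- The cone formula for `toSphere` needs measurable sets, and `p` need not be measurable.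
  set t := toMeasurable (sphereMeasure n) {x | ¬ p x} with ht
  have htm : MeasurableSet t := measurableSet_toMeasurable _ _
  have ht0 : sphereMeasure n t = 0 := by
    rw [ht, measure_toMeasurable]
    exact hp
  -- Nullity on the sphere is nullity of the cone. A linear equivalence changes Haar measure only by
  -- a constant factor, so the value of its determinant plays no role.
  have hpre : Ioo (0 : ℝ) 1 • ((↑) '' (sphereMap T ⁻¹' t) : Set (EuclideanSpace ℂ (Fin n))) ⊆
      e ⁻¹' (Ioo (0 : ℝ) 1 • ((↑) '' t)) := by
    rintro _ ⟨r, hr, _, ⟨x, hx, rfl⟩, rfl⟩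
    refine ⟨r, hr, _, ⟨_, hx, rfl⟩, ?_⟩
    exact ((e.map_smul r (x : EuclideanSpace ℂ (Fin n))).trans (by rw [heT]; rfl)).symm
  have hnull : sphereMeasure n (sphereMap T ⁻¹' t) = 0 := by
    rw [sphereMeasure, Measure.toSphere_apply' _ htm] at ht0
    rw [sphereMeasure, Measure.toSphere_apply' _ (hcont.measurable htm)]
    refine le_antisymm ?_ zero_le
    refine (mul_le_mul_right (measure_mono hpre) _).trans ?_
    rw [Measure.addHaar_preimage_linearEquiv, mul_left_comm, ht0, mul_zero]
  have hsub : ∀ y, ¬ p y → y ∈ t := fun y hy => subset_toMeasurable _ _ hy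
  exact measure_mono_null (fun x hx => hsub (sphereMap T x) hx) hnull

lemma HasNontangentialLimit.comp_isometry {n : ℕ} {f : EuclideanSpace ℂ (Fin n) → ℂ}
    (T : EuclideanSpace ℂ (Fin n) →ₗᵢ[ℂ] EuclideanSpace ℂ (Fin n))
    {ζ : EuclideanSpace ℂ (Fin n)} {L : ℂ} (h : HasNontangentialLimit f (T ζ) L) :
    HasNontangentialLimit (fun z => f (T z)) ζ L := by
  intro α hα
  refine (h α hα).comp (tendsto_nhdsWithin_iff.2
    ⟨(T.continuous.tendsto ζ).mono_left nhdsWithin_le_nhds, ?_⟩)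
  filter_upwards [self_mem_nhdsWithin] with z hz
  refine ⟨by rw [T.norm_map]; exact hz.1, ?_⟩
  rw [← map_sub, T.norm_map, T.norm_map]
  exact hz.2

/-! ### Truncation of the logarithm -/

/-- A function with integrable logarithm can be approximated, through truncations, so that
`M - (1 / 2) log w` is an increasing limit which converges fast in `L^{1/2}`. -/
theorem exists_log_approximation {X : Type*} [TopologicalSpace X] [CompactSpace X]
    [MeasurableSpace X] [OpensMeasurableSpace X] {μ : Measure X} [IsFiniteMeasure μ]
    {w : X → ℝ} (hw : Continuous w) (hpos : ∀ᵐ x ∂μ, 0 < w x)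
    (hlog : Integrable (fun x => Real.log (w x)) μ) :
    ∃ (M : ℝ) (v : ℕ → X → ℝ), (∀ k, Continuous (v k)) ∧ (∀ x, 0 < v 0 x) ∧
      (∀ k x, v k x ≤ v (k + 1) x) ∧ (Summable fun k => ∫ x, √(v (k + 1) x - v k x) ∂μ) ∧
      ∀ x, 0 < w x → Tendsto (fun k => v k x) atTop (𝓝 (M - 1 / 2 * Real.log (w x))) := by
  have int : ∀ {f : X → ℝ}, Continuous f → Integrable f μ := fun hf =>
    hf.integrable_of_hasCompactSupport (HasCompactSupport.of_compactSpace _)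
  obtain ⟨b, hb⟩ := isCompact_univ.exists_bound_of_continuousOn hw.continuousOn
  set B : ℝ := max b 1 with hB
  have hB1 : 1 ≤ B := le_max_right _ _
  have hwB : ∀ x, w x ≤ B := fun x =>
    (le_abs_self _).trans ((hb x (mem_univ x)).trans (le_max_left _ _))
  have hdom : Integrable (fun x => 1 + |Real.log (w x)|) μ := (integrable_const 1).add hlog.abs
  have hmeas : ∀ t : ℝ, MeasurableSet {x | w x < t} := fun t =>
    (isOpen_lt hw continuous_const).measurableSet
  have hD : Tendsto (fun j : ℕ => ∫ x, {x | w x < 1 / ((j : ℝ) + 1)}.indicator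
      (fun x => 1 + |Real.log (w x)|) x ∂μ) atTop (𝓝 0) := by
    have h0 : ∫ _ : X, (0 : ℝ) ∂μ = 0 := integral_zero _ _
    rw [← h0]
    refine tendsto_integral_of_dominated_convergence (fun x => 1 + |Real.log (w x)|)
      (fun j => hdom.aestronglyMeasurable.indicator (hmeas _)) hdom
      (fun j => Eventually.of_forall fun x => ?_) ?_
    · refine (norm_indicator_le_norm_self _ _).trans_eq ?_
      rw [Real.norm_of_nonneg (by positivity)]
    · filter_upwards [hpos] with x hx
      refine tendsto_const_nhds.congr' ?_
      filter_upwards [tendsto_one_div_add_atTop_nhds_zero_nat.eventually_le_const hx] with j hj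
      rw [indicator_of_notMem]
      exact not_lt.2 hj
  -- The sets `{w < 1 / (j + 1)}` shrink to a null set; a subsequence makes the integrals over them
  -- geometrically small.
  obtain ⟨φ, hφ, hφD⟩ := extraction_forall_of_eventually fun k : ℕ =>
    hD.eventually_le_const (show (0 : ℝ) < (1 / 2 : ℝ) ^ k by positivity)
  set t : ℕ → ℝ := fun k => 1 / ((φ k : ℝ) + 1) with ht
  have ht0 : ∀ k, 0 < t k := fun k => by positivity
  have ht1 : ∀ k, t k ≤ 1 := fun k => by
    rw [ht]
    simp only
    rw [div_le_one (by positivity)]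
    linarith [(Nat.cast_nonneg (φ k) : (0 : ℝ) ≤ φ k)]
  have htanti : ∀ k, t (k + 1) ≤ t k := fun k => by
    have : (φ k : ℝ) ≤ φ (k + 1) := by exact_mod_cast (hφ (Nat.lt_succ_self k)).le
    exact one_div_le_one_div_of_le (by positivity) (by linarith)
  have htlim : Tendsto t atTop (𝓝 0) :=
    tendsto_one_div_add_atTop_nhds_zero_nat.comp hφ.tendsto_atTop
  have hmax : ∀ k x, 0 < max (w x) (t k) := fun k x => lt_max_of_lt_right (ht0 k)
  -- The constant `1 / 2 * log B + 1` gives `v 0 ≥ 1`, because both `w` and the truncation level are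
  -- at most `B`.
  set v : ℕ → X → ℝ := fun k x =>
    1 / 2 * Real.log B + 1 - 1 / 2 * Real.log (max (w x) (t k)) with hv
  have hvc : ∀ k, Continuous (v k) := fun k =>
    continuous_const.sub (continuous_const.mul
      ((hw.max continuous_const).log fun x => (hmax k x).ne'))
  have hmono : ∀ k x, v k x ≤ v (k + 1) x := fun k x => by
    have := Real.log_le_log (hmax (k + 1) x) (max_le_max_left (w x) (htanti k))
    simp only [hv]
    linarith
  refine ⟨1 / 2 * Real.log B + 1, v, hvc, fun x => ?_, hmono, ?_, fun x hx => ?_⟩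
  · have := Real.log_le_log (hmax 0 x) (max_le (hwB x) ((ht1 0).trans hB1))
    simp only [hv]
    linarith
  · refine Summable.of_nonneg_of_le (fun k => integral_nonneg fun x => Real.sqrt_nonneg _)
      (fun k => ?_) summable_geometric_two
    refine le_trans ?_ (hφD k)
    refine integral_mono_ae (int ((hvc _).sub (hvc _)).sqrt) (hdom.indicator (hmeas _)) ?_
    filter_upwards [hpos] with x hx
    have hd : v (k + 1) x - v k x =
        1 / 2 * (Real.log (max (w x) (t k)) - Real.log (max (w x) (t (k + 1)))) := by
      simp only [hv]
      ring
    -- The increment lives on `{w < t k}` and is at most `|log w|` there; then `√s ≤ 1 + s` gives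
    -- the integrable bound.
    by_cases hxt : w x < t k
    · rw [indicator_of_mem (show x ∈ {x | w x < 1 / ((φ k : ℝ) + 1)} from hxt)]
      have h1 : Real.log (max (w x) (t k)) ≤ 0 :=
        Real.log_nonpos (hmax k x).le (max_le (hxt.le.trans (ht1 k)) (ht1 k))
      have h2 : Real.log (w x) ≤ Real.log (max (w x) (t (k + 1))) :=
        Real.log_le_log hx (le_max_left _ _)
      have h3 : v (k + 1) x - v k x ≤ |Real.log (w x)| := by
        rw [hd]
        linarith [neg_le_abs (Real.log (w x)), abs_nonneg (Real.log (w x))]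
      have h4 : 0 ≤ v (k + 1) x - v k x := sub_nonneg.2 (hmono k x)
      refine Real.sqrt_le_iff.2 ⟨by positivity, ?_⟩
      nlinarith [abs_nonneg (Real.log (w x))]
    · have hle := not_lt.1 hxt
      rw [indicator_of_notMem (show x ∉ {x | w x < 1 / ((φ k : ℝ) + 1)} from hxt), hd,
        max_eq_left hle, max_eq_left ((htanti k).trans hle)]
      simp
  · refine tendsto_const_nhds.congr' ?_
    filter_upwards [htlim.eventually_le_const hx] with k hk
    simp only [hv, max_eq_left hk]

end BallAdmissible

/-! ### Averaging over the group -/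

theorem mainTheorem6 (n : ℕ) (G : Subgroup (Matrix.unitaryGroup (Fin n) ℂ)) (hG : Finite G)
    (w : EuclideanSpace ℂ (Fin n) → ℝ)
    (hw_cont : ContinuousOn w (Metric.sphere 0 1))
    (hw_pos : ∀ᵐ ζ : Metric.sphere (0 : EuclideanSpace ℂ (Fin n)) 1
      ∂(BallAdmissible.sphereMeasure n), 0 < w ζ)
    (hw_inv : BallAdmissible.IsInvariantOn G w (Metric.sphere 0 1))
    (hw_log : Integrable
      (fun ζ : Metric.sphere (0 : EuclideanSpace ℂ (Fin n)) 1 => Real.log (w ζ))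
      (BallAdmissible.sphereMeasure n)) :
    BallAdmissible.IsAdmissible G w := by
  open BallAdmissible in
  have : IsFiniteMeasure (sphereMeasure n) := by
    unfold sphereMeasure
    infer_instance
  have := Fintype.ofFinite G
  obtain ⟨M, v, hvc, hv0, hmono, hvs, hvlim⟩ :=
    exists_log_approximation hw_cont.domRestrict hw_pos hw_log
  obtain ⟨F, hFd, hF⟩ := exists_holomorphic_re_limit n (sphereMeasure n) hvc hv0 hmono hvs
  have hcard : (Fintype.card G : ℂ) ≠ 0 := Nat.cast_ne_zero.2 Fintype.card_ne_zero
  refine ⟨fun z => Complex.exp (M - (Fintype.card G : ℂ)⁻¹ *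
    ∑ τ : G, F (unitaryIsometry τ.1 z)), ?_, fun z _ => Complex.exp_ne_zero _, ?_, ?_⟩
  · refine DifferentiableOn.cexp ((differentiableOn_const _).sub
      ((DifferentiableOn.fun_sum fun τ _ => ?_).const_mul _))
    refine hFd.comp (unitaryIsometry τ.1).toContinuousLinearMap.differentiable.differentiableOn
      fun z hz => ?_
    simpa using hz
  · intro τ hτ z _
    simp only [← unitaryIsometry_apply, ← unitaryIsometry_mul]
    -- Right translation by `τ` permutes the terms of the average.
    have := Equiv.sum_comp (Equiv.mulRight (⟨τ, hτ⟩ : G)) fun υ : G => F (unitaryIsometry υ.1 z)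
    simp only [Equiv.coe_mulRight, Subgroup.coe_mul] at this
    rw [this]
  -- Since `G` is finite, almost every `ζ` has its whole orbit in the good set of `F`.
  · have hall : ∀ᵐ ζ ∂(sphereMeasure n), ∀ τ : G, ∃ L : ℂ,
        HasNontangentialLimit F (sphereMap (unitaryIsometry τ.1) ζ) L ∧
        Tendsto (fun k => v k (sphereMap (unitaryIsometry τ.1) ζ)) atTop (𝓝 L.re) :=
      ae_all_iff.2 fun τ => ae_sphereMap (unitaryIsometry τ.1) hF
    filter_upwards [hall, hw_pos] with ζ hζ hwζ
    choose L hL hLv using hζ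
    have hre : ∀ τ : G, (L τ).re = M - 1 / 2 * Real.log (w ζ) := by
      intro τ
      have hwτ : w (sphereMap (unitaryIsometry τ.1) ζ : EuclideanSpace ℂ (Fin n)) = w ζ :=
        hw_inv τ.1 τ.2 ζ ζ.2
      have h := hvlim (sphereMap (unitaryIsometry τ.1) ζ) (by
        rw [Set.domRestrict_apply, hwτ]
        exact hwζ)
      rw [Set.domRestrict_apply, hwτ] at h
      exact tendsto_nhds_unique (hLv τ) h
    refine ⟨Complex.exp (M - (Fintype.card G : ℂ)⁻¹ * ∑ τ : G, L τ), fun α hα => ?_, ?_⟩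
    · refine (Complex.continuous_exp.tendsto _).comp (tendsto_const_nhds.sub
        (tendsto_const_nhds.mul (tendsto_finsetSum _ fun τ _ => ?_)))
      exact (hL τ).comp_isometry (unitaryIsometry τ.1) α hα
    · have hsum : ((Fintype.card G : ℂ)⁻¹ * ∑ τ : G, L τ).re = M - 1 / 2 * Real.log (w ζ) := by
        have h1 : (Fintype.card G : ℂ)⁻¹ = ((Fintype.card G : ℝ)⁻¹ : ℝ) := by push_cast; rfl
        have h2 : (Fintype.card G : ℝ) ≠ 0 := Nat.cast_ne_zero.2 Fintype.card_ne_zero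
        rw [h1, Complex.re_ofReal_mul, Complex.re_sum, Finset.sum_congr rfl fun τ _ => hre τ]
        simp only [Finset.sum_const, Finset.card_univ, nsmul_eq_mul]
        rw [inv_mul_cancel_left₀ h2]
      rw [Complex.norm_exp, Complex.sub_re, hsum, Complex.ofReal_re, sub_sub_cancel,
        ← Real.exp_nat_mul]
      push_cast
      rw [← mul_assoc, mul_one_div_cancel two_ne_zero, one_mul, Real.exp_log hwζ]
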